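/- Let $n\ge 1$. For a bounded domain (nonempty connected open set) $\Omega\subset\mathbb C^n$ and $z\in\Omega$, the squeezing function is $$S_\Omega(z)=\sup_{f}\ \sup\{r>0: B_r(0)\subset f(\Omega)\},$$ where $f$ ranges over all holomorphic embeddings $f:\Omega\to\mathbb B^n$ (injective holomorphic immersions that are homeomorphisms onto their image; not necessarily proper) with $f(z)=0$; here $B_r(0)$ is the open Euclidean ball of radius $r$ centred at $0$ and $\mathbb B^n=B_1(0)$. Let $(\Omega_j)_{j\in\mathbb N}$ be domains in $\mathbb C^n$ with $\Omega_j\subset\Omega_{j+1}$ for all $j$, let $\Omega=\bigcup_j\Omega_j$, and assume that $\Omega$ is bounded. Let $z\in\Omega$ and $\delta\in\mathbb R$, and assume that $S_{\Omega_j}(z)>1-\delta$ for all sufficiently large $j$. Then $S_\Omega(z)\ge 1-\delta$. -/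

import Mathlib

/-- A holomorphic embedding of the open set `Ω ⊆ ℂⁿ` into the unit ball `𝔹ⁿ`: a holomorphic map on
`Ω` with values in the open unit ball, which is an immersion and a homeomorphism onto its image
(in particular it is injective). It is not required to be proper. Only the values of `f` on `Ω`
matter. -/
structure IsBallEmbedding {n : ℕ} (Ω : Set (EuclideanSpace ℂ (Fin n)))
    (f : EuclideanSpace ℂ (Fin n) → EuclideanSpace ℂ (Fin n)) : Prop where
  holomorphic : DifferentiableOn ℂ f Ω
  immersion : ∀ x ∈ Ω, Function.Injective (fderiv ℂ f x)
  embedding : Topology.IsEmbedding (Ω.domRestrict f)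
  mapsTo_ball : Set.MapsTo f Ω (Metric.ball 0 1)

/-- `S_{Ω,f} = sup {r > 0 : B_r(0) ⊆ f(Ω)}`. -/
noncomputable def squeezingOf {n : ℕ} (Ω : Set (EuclideanSpace ℂ (Fin n)))
    (f : EuclideanSpace ℂ (Fin n) → EuclideanSpace ℂ (Fin n)) : ℝ :=
  sSup {r : ℝ | 0 < r ∧ Metric.ball 0 r ⊆ f '' Ω}

/-- The squeezing function `S_Ω(z)`: the supremum of `S_{Ω,f}` over all holomorphic embeddings
`f : Ω → 𝔹ⁿ` with `f z = 0`. For a bounded domain `Ω` in `ℂⁿ`, `n ≥ 1`, and `z ∈ Ω`, both suprema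
are over nonempty sets of reals that are bounded above by `1`. -/
noncomputable def squeezing {n : ℕ} (Ω : Set (EuclideanSpace ℂ (Fin n)))
    (z : EuclideanSpace ℂ (Fin n)) : ℝ :=
  sSup {s : ℝ | ∃ f : EuclideanSpace ℂ (Fin n) → EuclideanSpace ℂ (Fin n),
    IsBallEmbedding Ω f ∧ f z = 0 ∧ s = squeezingOf Ω f}

/-! Suppose r = 1 - δ > 0. The strict hypothesis gives, for large j, embeddings F_j of Ω_j with
F_j(z) = 0 whose images contain the fixed ball V of radius r, hence holomorphic inverses G_j : V →
Ω_j. Both families are uniformly bounded (the G_j because Ω is bounded), so they have holomorphic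
limits f on Ω and g on V; an ultrafilter takes the place of Montel subsequences.

The chain rule at 0 passes to the limit as f'(z) g'(0) = id, so neither Jacobian vanishes
identically, and Hurwitz (`HolomorphicLimitOn.det_fderiv_ne_zero`) makes both nowhere zero. Uniform
openness (`HolomorphicLimitAt.eventually_mem_image_ball`) then shows that f is injective and that
g(V) lies in Ω, not merely in its closure. Finally F_j(G_j(w)) = w gives f(g(w)) = w, so V ⊆ f(Ω).

Cauchy estimates uniform in j carry the analysis: they turn pointwise convergence into convergence
of derivatives. -/

open Filter Metric Set Topology

/-! ### Cauchy estimates with explicit constants -/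

section CauchyEstimates

variable {E F : Type*} [NormedAddCommGroup E] [NormedSpace ℂ E]
  [NormedAddCommGroup F] [NormedSpace ℂ F] {f : E → F} {x : E} {R M : ℝ}

theorem norm_fderiv_le_of_bounded_on_ball (hR : 0 < R) (hd : DifferentiableOn ℂ f (ball x R))
    (hM : ∀ y ∈ ball x R, ‖f y‖ ≤ M) : ‖fderiv ℂ f x‖ ≤ 2 * M / R := by
  refine Complex.norm_fderiv_le_div_of_mapsTo_ball hd (fun y hy => ?_) hR
  rw [mem_closedBall, dist_eq_norm]
  linarith [norm_sub_le (f y) (f x), hM y hy, hM x (mem_ball_self hR)]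

theorem norm_fderiv_le_of_mem_half_ball (hR : 0 < R) (hd : DifferentiableOn ℂ f (ball x R))
    (hM : ∀ y ∈ ball x R, ‖f y‖ ≤ M) {y : E} (hy : y ∈ ball x (R / 2)) :
    ‖fderiv ℂ f y‖ ≤ 4 * M / R := by
  have hsub : ball y (R / 2) ⊆ ball x R :=
    ball_subset_ball' (by linarith [mem_ball.1 hy])
  have := norm_fderiv_le_of_bounded_on_ball (by positivity) (hd.mono hsub)
    (fun w hw => hM w (hsub hw))
  convert this using 1
  field_simp
  ring

theorem norm_sub_le_of_mem_half_ball (hR : 0 < R) (hd : DifferentiableOn ℂ f (ball x R))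
    (hM : ∀ y ∈ ball x R, ‖f y‖ ≤ M) {y w : E} (hy : y ∈ ball x (R / 2))
    (hw : w ∈ ball x (R / 2)) : ‖f w - f y‖ ≤ 4 * M / R * ‖w - y‖ := by
  let : NormedSpace ℝ E := NormedSpace.restrictScalars ℝ ℂ E
  refine Convex.norm_image_sub_le_of_norm_fderiv_le (𝕜 := ℂ) (s := ball x (R / 2))
    (fun v hv => ?_) (fun v hv => norm_fderiv_le_of_mem_half_ball hR hd hM hv)
    (convex_ball _ _) hy hw
  exact hd.differentiableAt (isOpen_ball.mem_nhds (ball_subset_ball (by linarith) hv))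

/-- No second derivative is needed: the first-order estimate is applied to the translation
difference `f (v + (w - y)) - f v`, itself of size O(‖w - y‖). -/
theorem norm_fderiv_sub_le_of_mem_quarter_ball (hR : 0 < R)
    (hd : DifferentiableOn ℂ f (ball x R)) (hM : ∀ y ∈ ball x R, ‖f y‖ ≤ M) {y w : E}
    (hy : y ∈ ball x (R / 4)) (hw : w ∈ ball x (R / 4)) :
    ‖fderiv ℂ f w - fderiv ℂ f y‖ ≤ 32 * M / R ^ 2 * ‖w - y‖ := by
  have hdiff : ∀ v ∈ ball x (R / 2), DifferentiableAt ℂ f v := fun v hv =>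
    hd.differentiableAt (isOpen_ball.mem_nhds (ball_subset_ball (by linarith) hv))
  have hys : ∀ v ∈ ball y (R / 4), v ∈ ball x (R / 2) := fun v hv =>
    ball_subset_ball' (by linarith [mem_ball.1 hy]) hv
  have hws : ∀ v ∈ ball y (R / 4), v + (w - y) ∈ ball x (R / 2) := fun v hv => by
    have h1 : v + (w - y) ∈ ball w (R / 4) := by
      rw [mem_ball, dist_eq_norm] at hv ⊢
      convert hv using 2
      abel
    exact ball_subset_ball' (by linarith [mem_ball.1 hw]) h1
  have hcomp : ∀ v ∈ ball y (R / 4),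
      HasFDerivAt (fun v => f (v + (w - y)) - f v)
        (fderiv ℂ f (v + (w - y)) - fderiv ℂ f v) v := fun v hv =>
    ((hasFDerivAt_comp_add_right (w - y)).2 (hdiff _ (hws v hv)).hasFDerivAt).sub
      (hdiff _ (hys v hv)).hasFDerivAt
  have key := norm_fderiv_le_of_bounded_on_ball (f := fun v => f (v + (w - y)) - f v)
    (x := y) (R := R / 4) (M := 4 * M / R * ‖w - y‖) (by positivity)
    (fun v hv => (hcomp v hv).differentiableAt.differentiableWithinAt)
    (fun v hv => by
      simpa using norm_sub_le_of_mem_half_ball hR hd hM (hys v hv) (hws v hv))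
  rw [(hcomp y (mem_ball_self (by positivity))).fderiv, add_sub_cancel] at key
  refine key.trans (le_of_eq ?_)
  field_simp
  ring

/-- Mean value inequality for `f - A`. With `A` the derivative at `x` it is a quadratic Taylor
remainder; with `A` a nearby invertible map it feeds the inverse function theorem. -/
theorem norm_sub_sub_le_of_mem_closedBall (hR : 0 < R)
    (hd : DifferentiableOn ℂ f (ball x R)) (hM : ∀ y ∈ ball x R, ‖f y‖ ≤ M) (A : E →L[ℂ] F)
    {r : ℝ} (hr : r < R / 4) {y w : E} (hy : y ∈ closedBall x r) (hw : w ∈ closedBall x r) :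
    ‖f w - f y - A (w - y)‖ ≤
      (32 * M / R ^ 2 * r + ‖fderiv ℂ f x - A‖) * ‖w - y‖ := by
  let : NormedSpace ℝ E := NormedSpace.restrictScalars ℝ ℂ E
  have hM0 : 0 ≤ M := (norm_nonneg _).trans (hM x (mem_ball_self hR))
  refine Convex.norm_image_sub_le_of_norm_fderiv_le' (𝕜 := ℂ) (s := closedBall x r)
    (fun v hv => ?_) (fun v hv => ?_) (convex_closedBall _ _) hy hw
  · exact hd.differentiableAt
      (isOpen_ball.mem_nhds (closedBall_subset_ball (by linarith) hv))
  · have h1 := norm_fderiv_sub_le_of_mem_quarter_ball hR hd hM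
      (mem_ball_self (by positivity)) (closedBall_subset_ball hr hv)
    have h2 : ‖v - x‖ ≤ r := by rwa [mem_closedBall, dist_eq_norm] at hv
    calc ‖fderiv ℂ f v - A‖ = ‖(fderiv ℂ f v - fderiv ℂ f x) + (fderiv ℂ f x - A)‖ := by
          congr 1; abel
      _ ≤ ‖fderiv ℂ f v - fderiv ℂ f x‖ + ‖fderiv ℂ f x - A‖ := norm_add_le _ _
      _ ≤ _ := by
        gcongr
        exact h1.trans (by gcongr)

end CauchyEstimates

/-! ### Bounded pointwise limits of holomorphic maps -/

section Limits

variable {ι E F : Type*} [NormedAddCommGroup E] [NormedSpace ℂ E]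
  [NormedAddCommGroup F] [NormedSpace ℂ F]

/-- Along `l`, the maps `G i` are holomorphic and bounded by `M` on the ball of radius `R` about
`x`, and they converge to `g` pointwise on that ball. -/
structure HolomorphicLimitAt (l : Filter ι) (G : ι → E → F) (g : E → F) (x : E) (R M : ℝ) :
    Prop where
  radius_pos : 0 < R
  eventually_bounded : ∀ᶠ i in l, DifferentiableOn ℂ (G i) (ball x R) ∧
    ∀ y ∈ ball x R, ‖G i y‖ ≤ M
  tendsto : ∀ y ∈ ball x R, Tendsto (fun i => G i y) l (𝓝 (g y))

/-- Along `l`, the maps `G i` are locally holomorphic and uniformly bounded near each point of `U`,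
and they converge to `g` pointwise near each point of `U`. -/
def HolomorphicLimitOn (l : Filter ι) (G : ι → E → F) (g : E → F) (U : Set E) : Prop :=
  ∀ x ∈ U, ∃ R M, HolomorphicLimitAt l G g x R M

namespace HolomorphicLimitAt

variable {l : Filter ι} {G : ι → E → F} {g : E → F} {x : E} {R M : ℝ}

theorem mono_filter (h : HolomorphicLimitAt l G g x R M) {l' : Filter ι} (hl : l' ≤ l) :
    HolomorphicLimitAt l' G g x R M :=
  ⟨h.radius_pos, hl h.eventually_bounded, fun y hy => (h.tendsto y hy).mono_left hl⟩

theorem of_ball_subset (h : HolomorphicLimitAt l G g x R M) {y : E} {r : ℝ} (hr : 0 < r)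
    (hsub : ball y r ⊆ ball x R) : HolomorphicLimitAt l G g y r M :=
  ⟨hr, h.eventually_bounded.mono fun _ hi => ⟨hi.1.mono hsub, fun w hw => hi.2 w (hsub hw)⟩,
    fun w hw => h.tendsto w (hsub hw)⟩

theorem half_of_mem (h : HolomorphicLimitAt l G g x R M) {y : E} (hy : y ∈ ball x (R / 2)) :
    HolomorphicLimitAt l G g y (R / 2) M :=
  h.of_ball_subset (half_pos h.radius_pos) (ball_subset_ball' (by linarith [mem_ball.1 hy]))

theorem bound_nonneg [l.NeBot] (h : HolomorphicLimitAt l G g x R M) : 0 ≤ M := by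
  obtain ⟨i, hi⟩ := h.eventually_bounded.exists
  exact (norm_nonneg _).trans (hi.2 x (mem_ball_self h.radius_pos))

/-- The quadratic Taylor remainder has a constant independent of `i`, so it survives the pointwise
limit. -/
theorem hasFDerivAt_of_tendsto [l.NeBot] (h : HolomorphicLimitAt l G g x R M) {A : E →L[ℂ] F}
    (hA : Tendsto (fun i => fderiv ℂ (G i) x) l (𝓝 A)) : HasFDerivAt g A x := by
  have hR := h.radius_pos
  have hquad : ∀ y ∈ ball x (R / 4),
      ‖g y - g x - A (y - x)‖ ≤ 32 * M / R ^ 2 * ‖y - x‖ ^ 2 := fun y hy => by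
    have hlim : Tendsto (fun i => ‖G i y - G i x - fderiv ℂ (G i) x (y - x)‖) l
        (𝓝 ‖g y - g x - A (y - x)‖) :=
      (((h.tendsto y (ball_subset_ball (by linarith) hy)).sub
        (h.tendsto x (mem_ball_self hR))).sub
          ((ContinuousLinearMap.apply ℂ F (y - x)).continuous.continuousAt.tendsto.comp hA)).norm
    refine le_of_tendsto hlim (h.eventually_bounded.mono fun i hi => ?_)
    have hy' : ‖y - x‖ < R / 4 := by rwa [mem_ball, dist_eq_norm] at hy
    have := norm_sub_sub_le_of_mem_closedBall hR hi.1 hi.2 (fderiv ℂ (G i) x) hy'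
      (mem_closedBall_self (norm_nonneg _))
      (by rw [mem_closedBall, dist_eq_norm] : y ∈ closedBall x ‖y - x‖)
    refine this.trans (le_of_eq ?_)
    simp
    ring
  refine HasFDerivAt.of_isLittleO ?_
  have hO : (fun y => g y - g x - A (y - x)) =O[𝓝 x] fun y => ‖y - x‖ ^ 2 := by
    refine Asymptotics.IsBigO.of_bound (32 * M / R ^ 2) ?_
    filter_upwards [ball_mem_nhds x (show 0 < R / 4 by positivity)] with y hy
    simpa using hquad y hy
  refine hO.trans_isLittleO ?_
  have : (fun y => ‖y - x‖ ^ 2) =o[𝓝 x] fun y => ‖y - x‖ ^ 1 :=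
    (Asymptotics.isLittleO_pow_pow one_lt_two).comp_tendsto
      (tendsto_iff_norm_sub_tendsto_zero.1 tendsto_id)
  simpa using this

theorem exists_tendsto_fderiv [FiniteDimensional ℂ E] [FiniteDimensional ℂ F]
    {u : Ultrafilter ι} (h : HolomorphicLimitAt (u : Filter ι) G g x R M) :
    ∃ A, Tendsto (fun i => fderiv ℂ (G i) x) u (𝓝 A) := by
  have : ProperSpace (E →L[ℂ] F) := FiniteDimensional.proper ℂ _
  obtain ⟨A, -, hA⟩ := (isCompact_closedBall (0 : E →L[ℂ] F) (2 * M / R)).ultrafilter_le_nhds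
    (u.map fun i => fderiv ℂ (G i) x) (by
      rw [le_principal_iff]
      exact h.eventually_bounded.mono fun i hi => by
        simpa using norm_fderiv_le_of_bounded_on_ball h.radius_pos hi.1 hi.2)
  exact ⟨A, hA⟩

/-- Derivatives are bounded, so they converge along every finer ultrafilter; each such limit must be
the derivative of `g`. -/
theorem tendsto_fderiv [FiniteDimensional ℂ E] [FiniteDimensional ℂ F]
    (h : HolomorphicLimitAt l G g x R M) :
    Tendsto (fun i => fderiv ℂ (G i) x) l (𝓝 (fderiv ℂ g x)) := by
  rw [tendsto_iff_ultrafilter]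
  intro u hu
  obtain ⟨A, hA⟩ := (h.mono_filter hu).exists_tendsto_fderiv
  rwa [((h.mono_filter hu).hasFDerivAt_of_tendsto hA).fderiv]

theorem differentiableAt [FiniteDimensional ℂ E] [FiniteDimensional ℂ F] [l.NeBot]
    (h : HolomorphicLimitAt l G g x R M) : DifferentiableAt ℂ g x := by
  have hu := h.mono_filter (Ultrafilter.of_le l)
  obtain ⟨A, hA⟩ := hu.exists_tendsto_fderiv
  exact (hu.hasFDerivAt_of_tendsto hA).differentiableAt

theorem tendsto_apply (h : HolomorphicLimitAt l G g x R M) {p : ι → E}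
    (hp : Tendsto p l (𝓝 x)) : Tendsto (fun i => G i (p i)) l (𝓝 (g x)) := by
  have hR := h.radius_pos
  have hz : Tendsto (fun i => G i (p i) - G i x) l (𝓝 0) := by
    refine squeeze_zero_norm' (a := fun i => 4 * M / R * ‖p i - x‖) ?_ ?_
    · filter_upwards [h.eventually_bounded, hp (ball_mem_nhds x (half_pos hR))] with i hi hpi
      exact norm_sub_le_of_mem_half_ball hR hi.1 hi.2 (mem_ball_self (half_pos hR)) hpi
    · simpa using (tendsto_iff_norm_sub_tendsto_zero.1 hp).const_mul (4 * M / R)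
  simpa using hz.add (h.tendsto x (mem_ball_self hR))

/-- Uniform openness: if the limit has an invertible derivative at `x`, then points converging to
`g x` are eventually attained by `G i` near `x`. -/
theorem eventually_mem_image_ball [FiniteDimensional ℂ E] [Nontrivial E] {G : ι → E → E}
    {g : E → E} [l.NeBot] (h : HolomorphicLimitAt l G g x R M) (hdet : (fderiv ℂ g x).det ≠ 0)
    {p : ι → E} (hp : Tendsto p l (𝓝 (g x))) {ε : ℝ} (hε : 0 < ε) :
    ∀ᶠ i in l, p i ∈ G i '' ball x ε := by
  have : CompleteSpace E := FiniteDimensional.complete ℂ E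
  have hR := h.radius_pos
  have hM := h.bound_nonneg
  set A := (fderiv ℂ g x).toContinuousLinearEquivOfDetNeZero hdet with hAdef
  have hA : (A : E →L[ℂ] E) = fderiv ℂ g x :=
    ContinuousLinearMap.coe_toContinuousLinearEquivOfDetNeZero _ hdet
  set N : NNReal := ‖(A.symm : E →L[ℂ] E)‖₊ with hN
  have hNpos : 0 < N := A.nnnorm_symm_pos
  have hNR : (0 : ℝ) < (N : ℝ)⁻¹ := by positivity
  set K := 32 * M / R ^ 2 with hK
  have hK0 : 0 ≤ K := by positivity
  -- The variation of the derivative over the ball and its distance to `A` each cost a quarter of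
  -- `N⁻¹`. Half of `N⁻¹` remains, so `G i` covers the closed ball of radius `N⁻¹ / 2 * r` about `G
  -- i x`.
  obtain ⟨r, hr0, hrε, hrR, hrK⟩ : ∃ r, 0 < r ∧ r < ε ∧ r < R / 4 ∧ K * r ≤ (N : ℝ)⁻¹ / 4 := by
    have hc : Tendsto (fun r : ℝ => K * r) (𝓝 0) (𝓝 0) := by
      simpa using (continuous_const_mul K).tendsto 0
    have h1 : ∀ᶠ r in 𝓝[>] (0 : ℝ), K * r < (N : ℝ)⁻¹ / 4 :=
      (hc.mono_left nhdsWithin_le_nhds).eventually_lt_const (by positivity)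
    have h2 : ∀ᶠ r in 𝓝[>] (0 : ℝ), r < ε := nhdsWithin_le_nhds (Iio_mem_nhds hε)
    have h3 : ∀ᶠ r in 𝓝[>] (0 : ℝ), r < R / 4 :=
      nhdsWithin_le_nhds (Iio_mem_nhds (by positivity))
    have h4 : ∀ᶠ r in 𝓝[>] (0 : ℝ), 0 < r := self_mem_nhdsWithin
    obtain ⟨r, h1, h2, h3, h4⟩ := (h1.and (h2.and (h3.and h4))).exists
    exact ⟨r, h4, h2, h3, h1.le⟩
  have hder : ∀ᶠ i in l, ‖fderiv ℂ (G i) x - A‖ < (N : ℝ)⁻¹ / 4 := by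
    rw [hA]
    exact (tendsto_iff_norm_sub_tendsto_zero.1 h.tendsto_fderiv).eventually_lt_const
      (by positivity)
  have hdist : ∀ᶠ i in l, dist (p i) (G i x) < (N : ℝ)⁻¹ / 2 * r := by
    have := hp.dist (h.tendsto x (mem_ball_self hR))
    rw [dist_self] at this
    exact this.eventually_lt_const (by positivity)
  filter_upwards [h.eventually_bounded, hder, hdist] with i hi h1 h2
  have happ : ApproximatesLinearOn (G i) (A : E →L[ℂ] E) (closedBall x r) (N⁻¹ / 2) := by
    intro w hw y hy
    refine (norm_sub_sub_le_of_mem_closedBall hR hi.1 hi.2 _ hrR hy hw).trans ?_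
    gcongr
    push_cast
    linarith
  have hsurj := happ.surjOn_closedBall_of_nonlinearRightInverse A.toNonlinearRightInverse hr0.le
    subset_rfl
  have hmem : p i ∈ closedBall (G i x)
      (((A.toNonlinearRightInverse.nnnorm : ℝ)⁻¹ - (N⁻¹ / 2 : NNReal)) * r) := by
    rw [mem_closedBall]
    refine h2.le.trans (le_of_eq ?_)
    have : A.toNonlinearRightInverse.nnnorm = N := rfl
    rw [this]
    push_cast
    ring
  exact image_mono (closedBall_subset_ball hrε) (hsurj hmem)

end HolomorphicLimitAt

end Limits

/-! ### Holomorphy of the derivative and of the Jacobian determinant -/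

section Derivative

variable {E F : Type*} [NormedAddCommGroup E] [NormedSpace ℂ E]
  [NormedAddCommGroup F] [NormedSpace ℂ F]

/-- Difference quotients are holomorphic and uniformly bounded, so the limit theory above makes
directional derivatives holomorphic. -/
theorem DifferentiableOn.holomorphicLimitAt_slope {f : E → F} {x : E} {R M : ℝ} (hR : 0 < R)
    (hd : DifferentiableOn ℂ f (ball x R)) (hM : ∀ y ∈ ball x R, ‖f y‖ ≤ M) (w : E) :
    HolomorphicLimitAt (𝓝[≠] (0 : ℂ)) (fun t y => t⁻¹ • (f (y + t • w) - f y))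
      (fun y => fderiv ℂ f y w) x (R / 4) (4 * M / R * ‖w‖) := by
  refine ⟨by positivity, ?_, fun y hy => ?_⟩
  · have hc : Tendsto (fun t : ℂ => ‖t • w‖) (𝓝 0) (𝓝 0) := by
      have : Continuous fun t : ℂ => ‖t • w‖ := by fun_prop
      simpa using this.tendsto 0
    have hsmall : ∀ᶠ t in 𝓝[≠] (0 : ℂ), ‖t • w‖ < R / 4 :=
      (hc.mono_left nhdsWithin_le_nhds).eventually_lt_const (by positivity)
    filter_upwards [hsmall, self_mem_nhdsWithin] with t ht ht0
    have hin : ∀ y ∈ ball x (R / 4), y + t • w ∈ ball x (R / 2) := fun y hy => by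
      rw [mem_ball, dist_eq_norm] at hy ⊢
      calc ‖y + t • w - x‖ = ‖(y - x) + t • w‖ := by congr 1; abel
        _ ≤ ‖y - x‖ + ‖t • w‖ := norm_add_le _ _
        _ < R / 2 := by linarith
    have hin' : ball x (R / 4) ⊆ ball x (R / 2) := ball_subset_ball (by linarith)
    have hsub : ball x (R / 2) ⊆ ball x R := ball_subset_ball (by linarith)
    constructor
    · refine (DifferentiableOn.sub ?_ (hd.mono (hin'.trans hsub))).const_smul _
      exact hd.comp (differentiableOn_id.add_const _) fun y hy => hsub (hin y hy)
    · intro y hy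
      have := norm_sub_le_of_mem_half_ball hR hd hM (hin' hy) (hin y hy)
      rw [add_sub_cancel_left, norm_smul] at this
      rw [norm_smul, norm_inv]
      have ht1 : 0 < ‖t‖ := norm_pos_iff.2 ht0
      rw [inv_mul_le_iff₀ ht1]
      linarith
  · have hy' : DifferentiableAt ℂ f y :=
      hd.differentiableAt (isOpen_ball.mem_nhds (ball_subset_ball (by linarith) hy))
    have hl := hy'.hasFDerivAt.hasLineDerivAt w
    exact hl.tendsto_slope_zero

variable [FiniteDimensional ℂ F]

theorem HolomorphicLimitAt.comp_left {ι H : Type*} [NormedAddCommGroup H] [NormedSpace ℂ H]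
    {l : Filter ι} {G : ι → E → F} {g : E → F} {x : E}
    {R M : ℝ} (h : HolomorphicLimitAt l G g x R M) {φ : F → H} (hφ : Differentiable ℂ φ) :
    ∃ M', HolomorphicLimitAt l (fun i y => φ (G i y)) (fun y => φ (g y)) x R M' := by
  have : ProperSpace F := FiniteDimensional.proper ℂ F
  obtain ⟨C, hC⟩ := (isCompact_closedBall (0 : F) M).exists_bound_of_continuousOn
    hφ.continuous.continuousOn
  refine ⟨C, h.radius_pos, h.eventually_bounded.mono fun i hi => ⟨?_, fun y hy => ?_⟩,
    fun y hy => (hφ.continuous.tendsto _).comp (h.tendsto y hy)⟩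
  · exact hφ.comp_differentiableOn hi.1
  · exact hC _ (by simpa using hi.2 y hy)

variable [FiniteDimensional ℂ E]

theorem DifferentiableOn.fderiv_of_isOpen {f : E → F} {U : Set E} (hU : IsOpen U)
    (hd : DifferentiableOn ℂ f U) : DifferentiableOn ℂ (fderiv ℂ f) U := by
  intro x hx
  refine DifferentiableAt.differentiableWithinAt ?_
  obtain ⟨R, hR, hRU⟩ : ∃ R > 0, ball x R ⊆ U ∩ f ⁻¹' ball (f x) 1 :=
    Metric.mem_nhds_iff.1 (inter_mem (hU.mem_nhds hx)
      ((hd.continuousOn.continuousAt (hU.mem_nhds hx)) (ball_mem_nhds _ one_pos)))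
  have happ : ∀ w, DifferentiableAt ℂ (fun y => fderiv ℂ f y w) x := fun w =>
    (DifferentiableOn.holomorphicLimitAt_slope hR (hd.mono fun y hy => (hRU hy).1)
      (M := ‖f x‖ + 1) (fun y hy => by
        have h1 : ‖f y - f x‖ < 1 := by simpa [dist_eq_norm] using (hRU hy).2
        have h2 := norm_add_le (f x) (f y - f x)
        rw [add_sub_cancel] at h2
        linarith) w).differentiableAt
  let b := Module.finBasis ℂ E
  have hsum : fderiv ℂ f = fun y => ∑ i, (ContinuousLinearMap.smulRightL ℂ E F
      (LinearMap.toContinuousLinearMap (b.coord i))) (fderiv ℂ f y (b i)) := by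
    ext y v
    have hv := congrArg (fderiv ℂ f y) (b.sum_repr v)
    rw [map_sum] at hv
    simpa using hv.symm
  rw [hsum]
  refine DifferentiableAt.fun_sum fun i _ => ?_
  exact (ContinuousLinearMap.differentiableAt _).comp x (happ (b i))

theorem ContinuousLinearMap.differentiable_det :
    Differentiable ℂ fun A : E →L[ℂ] E => A.det := by
  let b := Module.finBasis ℂ E
  have hdet : (fun A : E →L[ℂ] E => A.det) = fun A => ∑ σ : Equiv.Perm _,
      ((Equiv.Perm.sign σ : ℤ) : ℂ) * ∏ i,
        LinearMap.toContinuousLinearMap (b.coord (σ i)) (A (b i)) := by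
    ext A
    change LinearMap.det (A : E →ₗ[ℂ] E) = _
    rw [← LinearMap.det_toMatrix b, Matrix.det_apply']
    simp [LinearMap.toMatrix_apply]
  rw [hdet]
  fun_prop

theorem HolomorphicLimitAt.fderiv {ι : Type*} {l : Filter ι} {G : ι → E → F} {g : E → F} {x : E}
    {R M : ℝ} (h : HolomorphicLimitAt l G g x R M) :
    HolomorphicLimitAt l (fun i => fderiv ℂ (G i)) (fderiv ℂ g) x (R / 2) (4 * M / R) := by
  refine ⟨half_pos h.radius_pos, h.eventually_bounded.mono fun i hi => ⟨?_, fun y hy => ?_⟩,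
    fun y hy => (h.half_of_mem hy).tendsto_fderiv⟩
  · exact (hi.1.fderiv_of_isOpen isOpen_ball).mono
      (ball_subset_ball (by linarith [h.radius_pos]))
  · exact norm_fderiv_le_of_mem_half_ball h.radius_pos hi.1 hi.2 hy

end Derivative

/-! ### Hurwitz's theorem -/

section Hurwitz

variable {ι E : Type*} [NormedAddCommGroup E] [NormedSpace ℂ E] {u : Ultrafilter ι}

/-- Hurwitz's theorem on a disc, at its centre. -/
theorem HolomorphicLimitAt.eventually_eq_zero_of_apply_eq_zero {h : ι → ℂ → ℂ} {k : ℂ → ℂ}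
    {R M : ℝ} (H : HolomorphicLimitAt (u : Filter ι) h k 0 R M)
    (hne : ∀ᶠ i in (u : Filter ι), ∀ ζ ∈ ball 0 R, h i ζ ≠ 0) (h0 : k 0 = 0) :
    ∀ ζ ∈ ball 0 (R / 2), k ζ = 0 := by
  have hR := H.radius_pos
  have hkd : DifferentiableOn ℂ k (ball 0 (R / 2)) := fun ζ hζ =>
    (H.half_of_mem hζ).differentiableAt.differentiableWithinAt
  have hka : AnalyticOnNhd ℂ k (ball 0 (R / 2)) := hkd.analyticOnNhd isOpen_ball
  have h0mem : (0 : ℂ) ∈ ball (0 : ℂ) (R / 2) := mem_ball_self (half_pos hR)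
  rcases (hka 0 h0mem).eventually_eq_zero_or_eventually_ne_zero with hz | hnz
  · exact hka.eqOn_zero_of_preconnected_of_eventuallyEq_zero
      (convex_ball _ _).isPreconnected h0mem hz
  exfalso
  obtain ⟨s, hs0, hs⟩ : ∃ s > 0, ball (0 : ℂ) s ⊆ {ζ | ζ ≠ 0 → k ζ ≠ 0} :=
    Metric.mem_nhds_iff.1 (eventually_nhdsWithin_iff.1 hnz)
  obtain ⟨ρ, hρ0, hρ⟩ : ∃ ρ, 0 < ρ ∧ ρ < min s (R / 2) :=
    exists_between (lt_min hs0 (half_pos hR))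
  have hρs : ρ < s := hρ.trans_le (min_le_left _ _)
  have hρR : ρ < R / 2 := hρ.trans_le (min_le_right _ _)
  have hsphere : sphere (0 : ℂ) ρ ⊆ ball 0 (R / 2) := fun ζ hζ => by
    simp only [mem_sphere_iff_norm, sub_zero, mem_ball, dist_zero_right] at *
    linarith
  obtain ⟨ζ₀, hζ₀, hmin⟩ := (isCompact_sphere (0 : ℂ) ρ).exists_isMinOn
    (NormedSpace.sphere_nonempty.2 hρ0.le) (hkd.continuousOn.mono hsphere).norm
  set m := ‖k ζ₀‖ with hm
  have hm0 : 0 < m := by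
    refine norm_pos_iff.2 (hs ?_ ?_)
    · simp only [mem_sphere_iff_norm, sub_zero, mem_ball, dist_zero_right] at *
      linarith
    · rintro rfl
      simp only [mem_sphere_iff_norm, sub_zero, norm_zero] at hζ₀
      exact hρ0.ne hζ₀
  -- Otherwise bad points on the circle converge along `u`, and continuous convergence gives `‖k‖ ≤
  -- m / 2` at their limit.
  have hlow : ∀ᶠ i in (u : Filter ι), ∀ ζ ∈ sphere (0 : ℂ) ρ, m / 2 ≤ ‖h i ζ‖ := by
    by_contra hcon
    rw [← Ultrafilter.eventually_not] at hcon
    have hcon' : ∀ᶠ i in (u : Filter ι), ∃ ζ ∈ sphere (0 : ℂ) ρ, ‖h i ζ‖ < m / 2 :=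
      hcon.mono fun i hi => by push Not at hi; exact hi
    obtain ⟨p, hp⟩ := hcon'.choice
    obtain ⟨ζ, hζ, hpζ⟩ := (isCompact_sphere (0 : ℂ) ρ).ultrafilter_le_nhds (u.map p) (by
      rw [le_principal_iff]
      exact hp.mono fun i hi => hi.1)
    have hlim := ((H.half_of_mem (hsphere hζ)).tendsto_apply (p := p) hpζ).norm
    have h1 : ‖k ζ‖ ≤ m / 2 := le_of_tendsto hlim (hp.mono fun i hi => hi.2.le)
    have h2 : m ≤ ‖k ζ‖ := hmin hζ
    linarith
  -- Maximum principle for `1 / h i`, carrying the lower bound from the circle to the centre,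
  -- against `k 0 = 0`.
  have hcen : ∀ᶠ i in (u : Filter ι), m / 2 ≤ ‖h i 0‖ := by
    filter_upwards [hlow, hne, H.eventually_bounded] with i h1 h2 h3
    have hsub : closedBall (0 : ℂ) ρ ⊆ ball 0 R := closedBall_subset_ball (by linarith)
    have hinv : DifferentiableOn ℂ (fun ζ => (h i ζ)⁻¹) (ball 0 R) := h3.1.inv h2
    have hb : ‖(h i 0)⁻¹‖ ≤ (m / 2)⁻¹ := by
      refine Complex.norm_le_of_forall_mem_frontier_norm_le (f := fun ζ => (h i ζ)⁻¹)
        (isBounded_ball (x := (0 : ℂ)) (r := ρ)) (hinv.diffContOnCl_ball hsub) (fun ζ hζ => ?_)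
        (subset_closure (mem_ball_self hρ0))
      rw [frontier_ball _ hρ0.ne'] at hζ
      rw [norm_inv]
      exact inv_anti₀ (by positivity) (h1 ζ hζ)
    rw [norm_inv] at hb
    exact (inv_le_inv₀ (norm_pos_iff.2 (h2 0 (mem_ball_self hR))) (by positivity)).1 hb
  have := ge_of_tendsto (H.tendsto 0 (mem_ball_self hR)).norm hcen
  rw [h0, norm_zero] at this
  linarith

/-- Restriction of a holomorphic limit to a complex line. -/
theorem HolomorphicLimitAt.line {l : Filter ι} {h : ι → E → ℂ} {k : E → ℂ} {a : E} {R M : ℝ}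
    (H : HolomorphicLimitAt l h k a R M) {v : E} {s : ℝ} (hs : 0 < s) (hv : s * ‖v‖ < R) :
    HolomorphicLimitAt l (fun i ζ => h i (a + ζ • v)) (fun ζ : ℂ => k (a + ζ • v)) 0 s M := by
  have hmaps : ∀ ζ ∈ ball (0 : ℂ) s, a + ζ • v ∈ ball a R := fun ζ hζ => by
    rw [mem_ball_zero_iff] at hζ
    rw [mem_ball, dist_eq_norm, add_sub_cancel_left, norm_smul]
    exact (mul_le_mul_of_nonneg_right hζ.le (norm_nonneg _)).trans_lt hv
  refine ⟨hs, H.eventually_bounded.mono fun i hi => ⟨?_, fun ζ hζ => hi.2 _ (hmaps ζ hζ)⟩,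
    fun ζ hζ => H.tendsto _ (hmaps ζ hζ)⟩
  refine hi.1.comp (t := ball a R) (f := fun ζ : ℂ => a + ζ • v) ?_ hmaps
  fun_prop

/-- Hurwitz's theorem in several variables. -/
theorem HolomorphicLimitOn.ne_zero_of_isPreconnected [FiniteDimensional ℂ E]
    {h : ι → E → ℂ} {k : E → ℂ} {U : Set E} (hU : IsOpen U) (hconn : IsPreconnected U)
    (H : HolomorphicLimitOn (u : Filter ι) h k U)
    (hne : ∀ x ∈ U, ∃ R > 0, ∀ᶠ i in (u : Filter ι), ∀ y ∈ ball x R, h i y ≠ 0)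
    {z : E} (hz : z ∈ U) (hkz : k z ≠ 0) : ∀ x ∈ U, k x ≠ 0 := by
  have hcont : ContinuousOn k U := fun x hx => by
    obtain ⟨R, M, hx⟩ := H x hx
    exact hx.differentiableAt.continuousAt.continuousWithinAt
  have hopen1 : IsOpen (U ∩ k ⁻¹' {0}ᶜ) := hcont.isOpen_inter_preimage hU isOpen_compl_singleton
  have hopen2 : IsOpen (U ∩ k ⁻¹' {0}) := by
    rw [isOpen_iff_mem_nhds]
    rintro a ⟨haU, ha0⟩
    obtain ⟨R₁, M, hlim⟩ := H a haU
    obtain ⟨R₂, hR₂, hne⟩ := hne a haU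
    set R := min R₁ R₂ with hRdef
    have hR : 0 < R := lt_min hlim.radius_pos hR₂
    replace hlim := hlim.of_ball_subset hR (ball_subset_ball (min_le_left _ _))
    filter_upwards [hU.mem_nhds haU, ball_mem_nhds a (show 0 < R / 3 by positivity)] with b hbU hb
    refine ⟨hbU, ?_⟩
    rw [mem_ball, dist_eq_norm] at hb
    -- The zero set is open: on the complex line through `a` and `b`, the disc version gives
    -- vanishing for `‖ζ‖ < 3 / 2`, which includes `ζ = 1`, the point `b`.
    have hline := hlim.line (v := b - a) (s := 3) (by norm_num) (by linarith)
    have hmem : ∀ ζ ∈ ball (0 : ℂ) 3, a + ζ • (b - a) ∈ ball a R₂ := fun ζ hζ => by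
      rw [mem_ball_zero_iff] at hζ
      rw [mem_ball, dist_eq_norm, add_sub_cancel_left, norm_smul]
      refine lt_of_le_of_lt (mul_le_mul_of_nonneg_right hζ.le (norm_nonneg _)) ?_
      linarith [min_le_right R₁ R₂]
    have := hline.eventually_eq_zero_of_apply_eq_zero
      (hne.mono fun i hi ζ hζ => hi _ (hmem ζ hζ)) (by simpa using ha0) 1 (by simp; norm_num)
    simpa using this
  have hsub : U ⊆ U ∩ k ⁻¹' {0}ᶜ := by
    refine hconn.subset_left_of_subset_union hopen1 hopen2 ?_ ?_ ⟨z, hz, hz, hkz⟩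
    · rw [Set.disjoint_left]
      rintro x ⟨-, h1⟩ ⟨-, h2⟩
      exact h1 h2
    · intro x hx
      by_cases h0 : k x = 0
      · exact Or.inr ⟨hx, h0⟩
      · exact Or.inl ⟨hx, h0⟩
  exact fun x hx => (hsub hx).2

/-- The Jacobian determinant version of Hurwitz's theorem. -/
theorem HolomorphicLimitOn.det_fderiv_ne_zero [FiniteDimensional ℂ E]
    {G : ι → E → E} {g : E → E} {U : Set E} (hU : IsOpen U) (hconn : IsPreconnected U)
    (H : HolomorphicLimitOn (u : Filter ι) G g U)
    (hne : ∀ x ∈ U, ∃ R > 0, ∀ᶠ i in (u : Filter ι), ∀ y ∈ ball x R,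
      (fderiv ℂ (G i) y).det ≠ 0)
    {z : E} (hz : z ∈ U) (hgz : (fderiv ℂ g z).det ≠ 0) : ∀ x ∈ U, (fderiv ℂ g x).det ≠ 0 := by
  refine HolomorphicLimitOn.ne_zero_of_isPreconnected (u := u) (k := fun x => (fderiv ℂ g x).det)
    hU hconn (h := fun i x => (fderiv ℂ (G i) x).det) (fun x hx => ?_) hne hz hgz
  obtain ⟨R, M, hx⟩ := H x hx
  obtain ⟨M', hM'⟩ := hx.fderiv.comp_left ContinuousLinearMap.differentiable_det
  exact ⟨_, _, hM'⟩

end Hurwitz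

/-! ### Montel's theorem -/

section Montel

variable {ι E F : Type*} [NormedAddCommGroup E] [NormedSpace ℂ E]
  [NormedAddCommGroup F] [NormedSpace ℂ F] [FiniteDimensional ℂ F]

/-- Montel's theorem along an ultrafilter. -/
theorem exists_holomorphicLimitOn (u : Ultrafilter ι) {G : ι → E → F} {U : Set E}
    (hU : IsOpen U) {M : ℝ}
    (hG : ∀ x ∈ U, ∃ R > 0, ∀ᶠ i in (u : Filter ι), DifferentiableOn ℂ (G i) (ball x R) ∧
      ∀ y ∈ ball x R, ‖G i y‖ ≤ M) :
    ∃ g : E → F, HolomorphicLimitOn (u : Filter ι) G g U := by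
  have : ProperSpace F := FiniteDimensional.proper ℂ F
  have hex : ∀ x ∈ U, ∃ y, Tendsto (fun i => G i x) u (𝓝 y) := fun x hx => by
    obtain ⟨R, hR, h⟩ := hG x hx
    obtain ⟨y, -, hy⟩ := (isCompact_closedBall (0 : F) M).ultrafilter_le_nhds
      (u.map fun i => G i x) (by
        rw [le_principal_iff]
        exact h.mono fun i hi => by simpa using hi.2 x (mem_ball_self hR))
    exact ⟨y, hy⟩
  choose! g hg using hex
  refine ⟨g, fun x hx => ?_⟩
  obtain ⟨R₁, hR₁, h⟩ := hG x hx
  obtain ⟨R₂, hR₂, hsub⟩ := Metric.isOpen_iff.1 hU x hx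
  refine ⟨min R₁ R₂, M, lt_min hR₁ hR₂, h.mono fun i hi => ?_,
    fun y hy => hg y (hsub (ball_subset_ball (min_le_right _ _) hy))⟩
  have hs : ball x (min R₁ R₂) ⊆ ball x R₁ := ball_subset_ball (min_le_left _ _)
  exact ⟨hi.1.mono hs, fun y hy => hi.2 y (hs hy)⟩

end Montel

/-! ### Inverses of embeddings, and a criterion for embeddings -/

section InverseMaps

theorem ContinuousLinearMap.det_ne_zero_of_injective {E : Type*} [NormedAddCommGroup E]
    [NormedSpace ℂ E] [FiniteDimensional ℂ E] {A : E →L[ℂ] E} (hA : Function.Injective A) :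
    A.det ≠ 0 := by
  have h : IsUnit (A : E →ₗ[ℂ] E) :=
    (LinearMap.isUnit_iff_ker_eq_bot _).2 (LinearMap.ker_eq_bot.2 hA)
  exact ((LinearMap.isUnit_iff_isUnit_det _).1 h).ne_zero

theorem ContinuousLinearMap.injective_of_det_ne_zero {E : Type*} [NormedAddCommGroup E]
    [NormedSpace ℂ E] [FiniteDimensional ℂ E] {A : E →L[ℂ] E} (hA : A.det ≠ 0) :
    Function.Injective A := by
  have h : IsUnit (A : E →ₗ[ℂ] E) :=
    (LinearMap.isUnit_iff_isUnit_det _).2 (isUnit_iff_ne_zero.2 hA)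
  exact LinearMap.ker_eq_bot.1 ((LinearMap.isUnit_iff_ker_eq_bot _).1 h)

theorem ContinuousLinearMap.det_ne_zero_of_comp_eq_id {E : Type*} [NormedAddCommGroup E]
    [NormedSpace ℂ E] {A B : E →L[ℂ] E}
    (h : A.comp B = ContinuousLinearMap.id ℂ E) : A.det ≠ 0 ∧ B.det ≠ 0 := by
  have hdet : A.det * B.det = 1 := by
    have : LinearMap.det ((A : E →ₗ[ℂ] E) ∘ₗ (B : E →ₗ[ℂ] E)) = 1 := by
      rw [← LinearMap.det_id (M := E) (A := ℂ)]
      exact congrArg (fun T : E →L[ℂ] E => LinearMap.det (T : E →ₗ[ℂ] E)) h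
    rwa [LinearMap.det_comp] at this
  exact ⟨left_ne_zero_of_mul_eq_one hdet, right_ne_zero_of_mul_eq_one hdet⟩

variable {n : ℕ} {Ω V : Set (EuclideanSpace ℂ (Fin n))}
  {f g : EuclideanSpace ℂ (Fin n) → EuclideanSpace ℂ (Fin n)}

theorem IsBallEmbedding.injOn (hf : IsBallEmbedding Ω f) : InjOn f Ω :=
  injOn_iff_injective.2 hf.embedding.injective

theorem IsBallEmbedding.det_fderiv_ne_zero (hf : IsBallEmbedding Ω f)
    {x : EuclideanSpace ℂ (Fin n)} (hx : x ∈ Ω) : (fderiv ℂ f x).det ≠ 0 :=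
  ContinuousLinearMap.det_ne_zero_of_injective (hf.immersion x hx)

theorem IsBallEmbedding.continuousOn_of_rightInverse (hf : IsBallEmbedding Ω f)
    (hg : MapsTo g V Ω) (hfg : ∀ w ∈ V, f (g w) = w) : ContinuousOn g V := by
  rw [continuousOn_iff_continuous_domRestrict]
  have hc : Continuous fun w : V => (⟨g w, hg w.2⟩ : Ω) := by
    rw [hf.embedding.continuous_iff]
    have : (Ω.domRestrict f ∘ fun w : V => (⟨g w, hg w.2⟩ : Ω)) = Subtype.val := by
      ext1 w
      exact hfg w w.2
    rw [this]
    exact continuous_subtype_val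
  exact continuous_subtype_val.comp hc

theorem IsBallEmbedding.differentiableOn_of_rightInverse (hΩ : IsOpen Ω) (hV : IsOpen V)
    (hf : IsBallEmbedding Ω f) (hg : MapsTo g V Ω) (hfg : ∀ w ∈ V, f (g w) = w) :
    DifferentiableOn ℂ g V := by
  intro w hw
  have hd := hf.det_fderiv_ne_zero (hg hw)
  have hder : HasFDerivAt f
      (((fderiv ℂ f (g w)).toContinuousLinearEquivOfDetNeZero hd :
        EuclideanSpace ℂ (Fin n) ≃L[ℂ] EuclideanSpace ℂ (Fin n)) :
        EuclideanSpace ℂ (Fin n) →L[ℂ] EuclideanSpace ℂ (Fin n)) (g w) := by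
    rw [ContinuousLinearMap.coe_toContinuousLinearEquivOfDetNeZero]
    exact (hf.holomorphic.differentiableAt (hΩ.mem_nhds (hg hw))).hasFDerivAt
  exact (HasFDerivAt.of_local_left_inverse
    ((hf.continuousOn_of_rightInverse hg hfg).continuousAt (hV.mem_nhds hw)) hder
    (Filter.mem_of_superset (hV.mem_nhds hw) hfg)).differentiableAt.differentiableWithinAt

theorem fderiv_comp_fderiv_of_rightInverse (hΩ : IsOpen Ω) (hV : IsOpen V)
    (hf : DifferentiableOn ℂ f Ω) (hgd : DifferentiableOn ℂ g V) (hg : MapsTo g V Ω)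
    (hfg : ∀ w ∈ V, f (g w) = w) {w : EuclideanSpace ℂ (Fin n)} (hw : w ∈ V) :
    (fderiv ℂ f (g w)).comp (fderiv ℂ g w) = ContinuousLinearMap.id ℂ _ := by
  have h1 := (hf.differentiableAt (hΩ.mem_nhds (hg hw))).hasFDerivAt.comp w
    (hgd.differentiableAt (hV.mem_nhds hw)).hasFDerivAt
  have h2 : HasFDerivAt (f ∘ g) (ContinuousLinearMap.id ℂ _) w :=
    (hasFDerivAt_id w).congr_of_eventuallyEq (Filter.mem_of_superset (hV.mem_nhds hw) hfg)
  exact h1.unique h2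

/-- An injective holomorphic immersion of an open set into the closed unit ball is a ball
embedding. -/
theorem IsBallEmbedding.of_injOn_of_norm_le (hΩ : IsOpen Ω) (hd : DifferentiableOn ℂ f Ω)
    (hdet : ∀ x ∈ Ω, (fderiv ℂ f x).det ≠ 0) (hinj : InjOn f Ω) (hle : ∀ x ∈ Ω, ‖f x‖ ≤ 1) :
    IsBallEmbedding Ω f := by
  have hmap : ∀ x ∈ Ω, map f (𝓝 x) = 𝓝 (f x) := fun x hx => by
    have hs : HasStrictFDerivAt f
        (((fderiv ℂ f x).toContinuousLinearEquivOfDetNeZero (hdet x hx) :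
          EuclideanSpace ℂ (Fin n) ≃L[ℂ] EuclideanSpace ℂ (Fin n)) :
          EuclideanSpace ℂ (Fin n) →L[ℂ] EuclideanSpace ℂ (Fin n)) x := by
      rw [ContinuousLinearMap.coe_toContinuousLinearEquivOfDetNeZero]
      refine hasStrictFDerivAt_of_hasFDerivAt_of_continuousAt (f' := fderiv ℂ f) ?_ ?_
      · filter_upwards [hΩ.mem_nhds hx] with y hy
        exact (hd.differentiableAt (hΩ.mem_nhds hy)).hasFDerivAt
      · exact (hd.fderiv_of_isOpen hΩ).continuousOn.continuousAt (hΩ.mem_nhds hx)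
    exact hs.map_nhds_eq_of_equiv
  have hopen : IsOpenMap (Ω.domRestrict f) := by
    refine IsOpenMap.of_nhds_le fun x => ?_
    change 𝓝 (f x) ≤ _
    rw [← hmap x x.2, ← hΩ.isOpenEmbedding_subtypeVal.map_nhds_eq x, Filter.map_map]
    rfl
  refine ⟨hd, fun x hx => ContinuousLinearMap.injective_of_det_ne_zero (hdet x hx), ?_, ?_⟩
  · exact (IsOpenEmbedding.of_continuous_injective_isOpenMap
      (continuousOn_iff_continuous_domRestrict.1 hd.continuousOn)
      (injOn_iff_injective.1 hinj) hopen).isEmbedding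
  · intro x hx
    -- Openness of `f` pushes values from the closed ball into its interior.
    rw [← interior_closedBall _ one_ne_zero, mem_interior_iff_mem_nhds, ← hmap x hx, mem_map]
    filter_upwards [hΩ.mem_nhds hx] with y hy
    simpa using hle y hy

end InverseMaps

/-! ### Suprema in the squeezing function -/

section Squeezing

variable {n : ℕ} {Ω : Set (EuclideanSpace ℂ (Fin n))} {z : EuclideanSpace ℂ (Fin n)}
  {f : EuclideanSpace ℂ (Fin n) → EuclideanSpace ℂ (Fin n)}

theorem squeezingOf_nonneg : 0 ≤ squeezingOf Ω f :=
  Real.sSup_nonneg fun _ h => h.1.le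

theorem squeezing_nonneg : 0 ≤ squeezing Ω z :=
  Real.sSup_nonneg fun _ ⟨_, _, _, h⟩ => h ▸ squeezingOf_nonneg

theorem exists_ball_subset_of_lt_squeezing {r : ℝ} (hr : 0 < r) (h : r < squeezing Ω z) :
    ∃ f, IsBallEmbedding Ω f ∧ f z = 0 ∧ ball 0 r ⊆ f '' Ω := by
  -- Since `sSup ∅ = 0`, positivity of `r` rules out the empty set.
  have key : ∀ S : Set ℝ, r < sSup S → ∃ s ∈ S, r < s := fun S hS => by
    refine exists_lt_of_lt_csSup (nonempty_iff_ne_empty.2 ?_) hS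
    rintro rfl
    rw [Real.sSup_empty] at hS
    exact hr.not_gt hS
  obtain ⟨_, ⟨f, hf, hfz, rfl⟩, hs⟩ := key _ h
  obtain ⟨ρ, ⟨-, hρ⟩, hrρ⟩ := key _ hs
  exact ⟨f, hf, hfz, (ball_subset_ball hrρ.le).trans hρ⟩

/-- A larger ball would contain a unit vector, which needs n ≥ 1. In dimension 0 every radius may
occur. -/
theorem IsBallEmbedding.radius_le_one [NeZero n] (hf : IsBallEmbedding Ω f) {ρ : ℝ}
    (hρ : ball 0 ρ ⊆ f '' Ω) : ρ ≤ 1 := by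
  by_contra! hlt
  have hmem : EuclideanSpace.single (0 : Fin n) (1 : ℂ) ∈ ball (0 : EuclideanSpace ℂ (Fin n)) ρ := by
    simpa using hlt
  obtain ⟨x, hx, hfx⟩ := hρ hmem
  have := hf.mapsTo_ball hx
  rw [hfx] at this
  simp at this

theorem IsBallEmbedding.le_squeezing [NeZero n] (hf : IsBallEmbedding Ω f) (hfz : f z = 0) {r : ℝ}
    (hr : 0 < r) (h : ball 0 r ⊆ f '' Ω) : r ≤ squeezing Ω z := by
  have h1 : r ≤ squeezingOf Ω f :=
    le_csSup ⟨1, fun _ hρ => hf.radius_le_one hρ.2⟩ ⟨hr, h⟩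
  refine h1.trans (le_csSup ⟨1, ?_⟩ ⟨f, hf, hfz, rfl⟩)
  rintro _ ⟨g, hg, -, rfl⟩
  exact Real.sSup_le (fun ρ hρ => hg.radius_le_one hρ.2) zero_le_one

end Squeezing

/-! ### The limit embedding and the theorem -/

/-- Along an increasing sequence of domains with bounded union, embeddings into the unit ball whose
images contain a fixed ball about the origin have a limit with the same property. -/
theorem exists_isBallEmbedding_iUnion {n : ℕ} [NeZero n] {Ω : ℕ → Set (EuclideanSpace ℂ (Fin n))}
    (hopen : ∀ j, IsOpen (Ω j)) (hconn : IsPreconnected (⋃ j, Ω j)) (hmono : Monotone Ω)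
    (hbdd : Bornology.IsBounded (⋃ j, Ω j)) {z : EuclideanSpace ℂ (Fin n)}
    (hz : z ∈ ⋃ j, Ω j) {r : ℝ} (hr : 0 < r)
    (hS : ∀ᶠ j in atTop, ∃ f, IsBallEmbedding (Ω j) f ∧ f z = 0 ∧ ball 0 r ⊆ f '' Ω j) :
    ∃ f, IsBallEmbedding (⋃ j, Ω j) f ∧ f z = 0 ∧ ball 0 r ⊆ f '' ⋃ j, Ω j := by
  set U := ⋃ j, Ω j with hUdef
  have hUo : IsOpen U := isOpen_iUnion hopen
  set V := ball (0 : EuclideanSpace ℂ (Fin n)) r with hV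
  have hVo : IsOpen V := isOpen_ball
  have h0V : (0 : EuclideanSpace ℂ (Fin n)) ∈ V := mem_ball_self hr
  set u : Ultrafilter ℕ := Filter.hyperfilter ℕ with hu
  have hule : (u : Filter ℕ) ≤ atTop := Nat.hyperfilter_le_atTop
  obtain ⟨F, hF⟩ := hS.choice
  replace hF : ∀ᶠ j in (u : Filter ℕ),
      IsBallEmbedding (Ω j) (F j) ∧ F j z = 0 ∧ V ⊆ F j '' Ω j := hule hF
  have hinv : ∀ᶠ j in (u : Filter ℕ),
      ∃ g : EuclideanSpace ℂ (Fin n) → EuclideanSpace ℂ (Fin n),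
        MapsTo g V (Ω j) ∧ ∀ w ∈ V, F j (g w) = w := by
    filter_upwards [hF] with j hj
    have : ∀ w ∈ V, ∃ x ∈ Ω j, F j x = w := fun w hw => hj.2.2 hw
    choose! g hg using this
    exact ⟨g, fun w hw => (hg w hw).1, fun w hw => (hg w hw).2⟩
  obtain ⟨G, hG⟩ := hinv.choice
  have hmem : ∀ x ∈ U, ∀ᶠ j in (u : Filter ℕ), x ∈ Ω j := fun x hx => by
    obtain ⟨k, hk⟩ := mem_iUnion.1 hx
    exact hule ((eventually_ge_atTop k).mono fun j hj => hmono hj hk)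
  have hballs : ∀ x ∈ U, ∃ R > 0, ∀ᶠ j in (u : Filter ℕ), ball x R ⊆ Ω j := fun x hx => by
    obtain ⟨k, hk⟩ := mem_iUnion.1 hx
    obtain ⟨R, hR, hsub⟩ := Metric.isOpen_iff.1 (hopen k) x hk
    exact ⟨R, hR, hule ((eventually_ge_atTop k).mono fun j hj => hsub.trans (hmono hj))⟩
  have hGd : ∀ᶠ j in (u : Filter ℕ), DifferentiableOn ℂ (G j) V := by
    filter_upwards [hF, hG] with j h1 h2
    exact h1.1.differentiableOn_of_rightInverse (hopen j) hVo h2.1 h2.2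
  have hG0 : ∀ᶠ j in (u : Filter ℕ), G j 0 = z := by
    filter_upwards [hF, hG, hmem z hz] with j h1 h2 h3
    exact h1.1.injOn (h2.1 h0V) h3 ((h2.2 0 h0V).trans h1.2.1.symm)
  have hFG : ∀ᶠ j in (u : Filter ℕ), ∀ w ∈ V,
      (fderiv ℂ (F j) (G j w)).comp (fderiv ℂ (G j) w) = ContinuousLinearMap.id ℂ _ := by
    filter_upwards [hF, hG, hGd] with j h1 h2 h3 w hw
    exact fderiv_comp_fderiv_of_rightInverse (hopen j) hVo h1.1.holomorphic h3 h2.1 h2.2 hw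
  obtain ⟨C, hC⟩ := hbdd.exists_norm_le
  obtain ⟨f, hf⟩ : ∃ f, HolomorphicLimitOn (u : Filter ℕ) F f U := by
    refine exists_holomorphicLimitOn u hUo (M := 1) fun x hx => ?_
    obtain ⟨R, hR, hsub⟩ := hballs x hx
    refine ⟨R, hR, ?_⟩
    filter_upwards [hF, hsub] with j h1 h2
    exact ⟨h1.1.holomorphic.mono h2, fun y hy => by
      simpa using (mem_ball_zero_iff.1 (h1.1.mapsTo_ball (h2 hy))).le⟩
  obtain ⟨g, hg⟩ : ∃ g, HolomorphicLimitOn (u : Filter ℕ) G g V := by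
    refine exists_holomorphicLimitOn u hVo (M := C) fun x hx => ?_
    obtain ⟨R, hR, hsub⟩ := Metric.isOpen_iff.1 hVo x hx
    refine ⟨R, hR, ?_⟩
    filter_upwards [hG, hGd] with j h1 h2
    exact ⟨h2.mono hsub, fun y hy => hC _ (mem_iUnion.2 ⟨j, h1.1 (hsub hy)⟩)⟩
  have hflim : ∀ x ∈ U, Tendsto (fun j => F j x) u (𝓝 (f x)) := fun x hx => by
    obtain ⟨R, M, h⟩ := hf x hx
    exact h.tendsto x (mem_ball_self h.radius_pos)
  have hglim : ∀ x ∈ V, Tendsto (fun j => G j x) u (𝓝 (g x)) := fun x hx => by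
    obtain ⟨R, M, h⟩ := hg x hx
    exact h.tendsto x (mem_ball_self h.radius_pos)
  have hfz : f z = 0 := tendsto_nhds_unique (hflim z hz)
    (tendsto_const_nhds.congr' (hF.mono fun j hj => hj.2.1.symm))
  -- The base points `G j 0 = z` do not move, so convergence of derivatives at fixed points
  -- suffices.
  have hcomp : (fderiv ℂ f z).comp (fderiv ℂ g 0) = ContinuousLinearMap.id ℂ _ := by
    obtain ⟨_, _, h1⟩ := hf z hz
    obtain ⟨_, _, h2⟩ := hg 0 h0V
    refine tendsto_nhds_unique 
      (((isBoundedBilinearMap_comp (𝕜 := ℂ)).continuous.tendsto _).comp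
        (h1.tendsto_fderiv.prodMk_nhds h2.tendsto_fderiv))
      (tendsto_const_nhds.congr' ?_)
    filter_upwards [hFG, hG0] with j h3 h4
    rw [← h3 0 h0V, h4]
    rfl
  obtain ⟨hfz', hg0'⟩ := ContinuousLinearMap.det_ne_zero_of_comp_eq_id hcomp
  have hfdet : ∀ x ∈ U, (fderiv ℂ f x).det ≠ 0 := by
    refine hf.det_fderiv_ne_zero hUo hconn (fun x hx => ?_) hz hfz'
    obtain ⟨R, hR, hsub⟩ := hballs x hx
    refine ⟨R, hR, ?_⟩
    filter_upwards [hF, hsub] with j h1 h2 y hy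
    exact h1.1.det_fderiv_ne_zero (h2 hy)
  have hgdet : ∀ w ∈ V, (fderiv ℂ g w).det ≠ 0 := by
    refine hg.det_fderiv_ne_zero hVo (convex_ball _ _).isPreconnected (fun x hx => ?_) h0V hg0'
    obtain ⟨R, hR, hsub⟩ := Metric.isOpen_iff.1 hVo x hx
    exact ⟨R, hR, hFG.mono fun j hj y hy =>
      (ContinuousLinearMap.det_ne_zero_of_comp_eq_id (hj y (hsub hy))).2⟩
  -- If f(a) = f(b) with a ≠ b, then F_j(b) → f(a), so uniform openness finds y near a, away from b,
  -- with F_j(y) = F_j(b).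
  have hinj : InjOn f U := by
    intro a ha b hb hab
    by_contra hne
    obtain ⟨_, _, h⟩ := hf a ha
    obtain ⟨R, hR, hsub⟩ := hballs a ha
    have hev := h.eventually_mem_image_ball (hfdet a ha) (p := fun j => F j b)
      (by rw [hab]; exact hflim b hb) (lt_min hR (dist_pos.2 hne))
    obtain ⟨j, ⟨y, hy, hyb⟩, h1, h2, h3⟩ := (hev.and (hF.and (hsub.and (hmem b hb)))).exists
    have hyb' : y = b :=
      h1.1.injOn (h2 (ball_subset_ball (min_le_left _ _) hy)) h3 hyb
    have := (mem_ball.1 hy).trans_le (min_le_right _ _)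
    rw [hyb', dist_comm] at this
    exact this.false
  -- Uniform openness with the constant target `g w` shows that `g w` is itself a value of some `G
  -- j`.
  have hgU : MapsTo g V U := by
    intro w hw
    obtain ⟨_, _, h⟩ := hg w hw
    obtain ⟨R, hR, hsub⟩ := Metric.isOpen_iff.1 hVo w hw
    have hev := h.eventually_mem_image_ball (hgdet w hw) (p := fun _ => g w)
      tendsto_const_nhds hR
    obtain ⟨j, ⟨y, hy, hyw⟩, h1⟩ := (hev.and hG).exists
    rw [← hyw]
    exact mem_iUnion.2 ⟨j, h1.1 (hsub hy)⟩
  refine ⟨f, IsBallEmbedding.of_injOn_of_norm_le hUo (fun x hx => ?_) hfdet hinj fun x hx => ?_,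
    hfz, fun w hw => ⟨g w, hgU hw, ?_⟩⟩
  · obtain ⟨_, _, h⟩ := hf x hx
    exact h.differentiableAt.differentiableWithinAt
  · refine le_of_tendsto (hflim x hx).norm ?_
    filter_upwards [hF, hmem x hx] with j h1 h2
    exact (mem_ball_zero_iff.1 (h1.1.mapsTo_ball h2)).le
  · obtain ⟨_, _, h⟩ := hf (g w) (hgU hw)
    exact tendsto_nhds_unique (h.tendsto_apply (hglim w hw))
      (tendsto_const_nhds.congr' (hG.mono fun j hj => (hj.2 w hw).symm))

theorem lemma3p2 {n : ℕ} (Ω : ℕ → Set (EuclideanSpace ℂ (Fin n)))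
    (hopen : ∀ j, IsOpen (Ω j)) (hconn : ∀ j, IsConnected (Ω j))
    (hmono : ∀ j, Ω j ⊆ Ω (j + 1))
    (hbdd : Bornology.IsBounded (⋃ j, Ω j))
    (z : EuclideanSpace ℂ (Fin n)) (hz : z ∈ ⋃ j, Ω j) (δ : ℝ)
    (hS : ∀ᶠ j in Filter.atTop, 1 - δ < squeezing (Ω j) z) :
    1 - δ ≤ squeezing (⋃ j, Ω j) z := by
  rcases le_or_gt (1 - δ) 0 with hδ | hδ
  · exact hδ.trans squeezing_nonneg
  have hm : Monotone Ω := monotone_nat_of_le_succ hmono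
  -- In dimension 0 all the domains are the same single point.
  rcases Nat.eq_zero_or_pos n with rfl | hn
  · obtain ⟨j, hj⟩ := hS.exists
    have huniv : ⋃ j, Ω j = Ω j := by
      rw [Subsingleton.eq_univ_of_nonempty (hconn j).nonempty,
        Subsingleton.eq_univ_of_nonempty ⟨z, hz⟩]
    rw [huniv]
    exact hj.le
  have : NeZero n := ⟨hn.ne'⟩
  have hpre : IsPreconnected (⋃ j, Ω j) := by
    refine IsPreconnected.iUnion_of_chain (fun j => (hconn j).isPreconnected) fun j => ?_
    rw [Order.succ_eq_add_one, inter_eq_left.2 (hmono j)]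
    exact (hconn j).nonempty
  obtain ⟨f, hf, hfz, hsub⟩ := exists_isBallEmbedding_iUnion hopen hpre hm hbdd hz hδ
    (hS.mono fun j hj => exists_ball_subset_of_lt_squeezing hδ hj)
  exact hf.le_squeezing hfz hδ hsub
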